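/- Let $\Omega\subset\mathbb R^d$ be a domain whose closure is the union of a finite family $\mathcal M$ of closed boxes $K=\prod_{j}[a_j^K,b_j^K]$ (possibly non-uniform) with pairwise disjoint interiors and matching faces: any two faces of cells whose relative interiors intersect coincide. A face $\sigma$ is internal, $\sigma=K|L$, if it is a common face of two different cells $K,L\in\mathcal M$, and external otherwise; $\mathcal E(K)$ is the set of faces of $K$, $\mathcal E^{(i)}_{\rm int}$ the set of internal faces orthogonal to the $i$-th unit vector $e^{(i)}$, $\nu_{\sigma,K}$ the unit normal to $\sigma$ outward to $K$, and $|K|$, $|\sigma|$ are Lebesgue measures. For $\sigma=K|L\in\mathcal E^{(i)}_{\rm int}$ the dual cell $D_\sigma$ is the union of the halves $D_{\sigma,K}$, $D_{\sigma,L}$ of $K$ and $L$ adjacent to $\sigma$, so that $|D_\sigma|=\frac12|K|+\frac12|L|$. Let $L_{\mathcal M}(\Omega)$ be the space of functions $q$ constant (equal to $q_K$) on each cell $K$, and $H_{\mathcal E,0}(\Omega)$ the space of discrete velocities $u=(u_\sigma)$, with one value for each face $\sigma$ (the component $u_i$ if $\sigma\perp e^{(i)}$), vanishing on external faces. For $q\in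 L_{\mathcal M}(\Omega)$ and $\sigma=K|L\in\mathcal E^{(i)}_{\rm int}$ put $$q_{D_\sigma}=\frac{\frac12|K|q_K+\frac12|L|q_L}{|D_\sigma|},\qquad (\partial^{(i)}_{\mathcal E}q)_\sigma=\frac{|\sigma|}{|D_\sigma|}(q_L-q_K)\,e^{(i)}\cdot\nu_{\sigma,K},$$ and $(\partial^{(i)}_{\mathcal E}q)_\sigma=0$ on external faces. Let $\gamma\ge1$, $p(\rho)=\rho^\gamma$, $\varepsilon\in(0,1]$, $\eta>0$, $\delta t>0$, and write $a^\pm=\frac12(a\pm|a|)$ and $a_{\sigma,K}=a_\sigma\,e^{(i)}\cdot\nu_{\sigma,K}$. For $u\in H_{\mathcal E,0}(\Omega)$ and $\rho\in L_{\mathcal M}(\Omega)$ with $\rho>0$ let $v=u-\delta u(\rho)$ be the stabilised velocity, $\delta u_\sigma(\rho)=\frac{\eta\,\delta t}{\varepsilon^2}(\partial^{(i)}_{\mathcal E}p(\rho))_\sigma$, with the splitting $$(v_{\sigma,K})^+=(u_{\sigma,K})^+-(\delta u_{\sigma,K}(\rho))^-\ge0,\qquad (v_{\sigma,K})^-=(u_{\sigma,K})^--(\delta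 u_{\sigma,K}(\rho))^+\le0 ,$$ and let the primal mass fluxes be $F_{\sigma,K}(\rho,v)=|\sigma|\{\rho_K(v_{\sigma,K})^++\rho_L(v_{\sigma,K})^-\}$ for $\sigma=K|L$ and $F_{\sigma,K}=0$ for external $\sigma$. For $\sigma=K|L\in\mathcal E^{(i)}_{\rm int}$ the mass fluxes $F_{\epsilon,\sigma}(\rho,v)$ out of $D_\sigma$ through the faces $\epsilon$ of $D_\sigma$ are as follows. If $\epsilon\perp e^{(i)}$ lies inside $K$ (similarly for $L$) and $\sigma'$ is the face of $K$ opposite to $\sigma$, then $F_{\epsilon,\sigma}=\frac12(F_{\sigma',K}-F_{\sigma,K})$. If $\epsilon\not\perp e^{(i)}$, then $\epsilon$ consists of a half of a face $\tau$ of $K$ and a half of a face $\tau'$ of $L$, and $F_{\epsilon,\sigma}=\frac12(F_{\tau,K}+F_{\tau',L})$. The upwind value $u_{\epsilon,\rm up}$ is $u_\sigma$ if $F_{\epsilon,\sigma}\ge0$ and $u_{\sigma'}$ otherwise, where $\sigma'\perp e^{(i)}$ is the face whose dual cell lies on the other side of $\epsilon$ (so $u_{\sigma'}=0$ if $\sigma'$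 is external). **Theorem.** Let $(\rho^n,u^n)\in L_{\mathcal M}(\Omega)\times H_{\mathcal E,0}(\Omega)$ with $\rho^n>0$ on $\Omega$. Then there exists $(\rho^{n+1},u^{n+1})\in L_{\mathcal M}(\Omega)\times H_{\mathcal E,0}(\Omega)$ with $\rho^{n+1}>0$ on $\Omega$ which solves the scheme: with $v^n=u^n-\delta u(\rho^{n+1})$ and $p^{n+1}=p(\rho^{n+1})$, $$\frac1{\delta t}(\rho^{n+1}_K-\rho^n_K)+\frac1{|K|}\sum_{\sigma\in\mathcal E(K)}F_{\sigma,K}(\rho^{n+1},v^n)=0\quad\text{for all }K\in\mathcal M,$$ $$\frac1{\delta t}\big(\rho^{n+1}_{D_\sigma}u^{n+1}_\sigma-\rho^n_{D_\sigma}u^n_\sigma\big)+\frac1{|D_\sigma|}\sum_{\epsilon}F_{\epsilon,\sigma}(\rho^{n+1},v^n)\,u^n_{\epsilon,\rm up}+\frac1{\varepsilon^2}(\partial^{(i)}_{\mathcal E}p^{n+1})_\sigma=0\quad\text{for all }1\le i\le d,\ \sigma\in\mathcal E^{(i)}_{\rm int},$$ where the second sum runs over the faces $\epsilon$ of $D_\sigma$.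 -/

import Mathlib

open BoxIntegral

noncomputable section

/-- An axis-parallel `(d-1)`-dimensional face in `ℝ^d`, orthogonal to the unit vector `e^(dir)`:
the product of the intervals `[lower j, upper j]`, degenerate in the direction `dir`. -/
structure Face (d : ℕ) where
  dir : Fin d
  lower : Fin d → ℝ
  upper : Fin d → ℝ

namespace Face

variable {d : ℕ}

/-- The surface measure `|σ|` of a face. -/
def area (σ : Face d) : ℝ := ∏ j ∈ Finset.univ.erase σ.dir, (σ.upper j - σ.lower j)

/-- The relative interior of a face. -/
def relInt (σ : Face d) : Set (Fin d → ℝ) :=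
  {x | x σ.dir = σ.lower σ.dir ∧ ∀ j, j ≠ σ.dir → x j ∈ Set.Ioo (σ.lower j) (σ.upper j)}

end Face

/-- The face of the box `K` orthogonal to `e^(i)`: the upper one (outward normal `e^(i)`)
for `s = true`, the lower one (outward normal `-e^(i)`) for `s = false`. -/
def boxFace {d : ℕ} (K : Box (Fin d)) (i : Fin d) (s : Bool) : Face d where
  dir := i
  lower := Function.update K.lower i (if s then K.upper i else K.lower i)
  upper := Function.update K.upper i (if s then K.upper i else K.lower i)

/-- A MAC grid on `Ω ⊆ ℝ^d`: finitely many closed boxes with disjoint interiors whose union is the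
closure of `Ω`, and whose faces are matching (no hanging nodes): two faces with intersecting
relative interiors coincide. The boxes may be non-uniform. -/
structure MACGrid (d : ℕ) (Ω : Set (Fin d → ℝ)) where
  cells : Finset (Box (Fin d))
  iUnion_cells : ⋃ K ∈ cells, Box.Icc K = closure Ω
  disjoint_interior : ∀ K ∈ cells, ∀ L ∈ cells, K ≠ L → Disjoint (Box.Ioo K) (Box.Ioo L)
  conforming : ∀ K ∈ cells, ∀ L ∈ cells, ∀ (i j : Fin d) (s t : Bool),
    ((boxFace K i s).relInt ∩ (boxFace L j t).relInt).Nonempty → boxFace K i s = boxFace L j t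

/-- The positive part `a⁺ = (a + |a|) / 2`. -/
def plusPart (a : ℝ) : ℝ := (a + |a|) / 2

/-- The (nonpositive) negative part `a⁻ = (a - |a|) / 2`. -/
def minusPart (a : ℝ) : ℝ := (a - |a|) / 2

/-- `e^(i) · ν` for the outward normal `ν` on the upper (`true`) or lower (`false`) side. -/
def sideSign (s : Bool) : ℝ := if s then 1 else -1

/-- The barotropic equation of state `p(ρ) = ρ^γ`. -/
def pressure (γ r : ℝ) : ℝ := r ^ γ

namespace MACGrid

variable {d : ℕ} {Ω : Set (Fin d → ℝ)} (G : MACGrid d Ω)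

/-- The primal cells. -/
abbrev Cell : Type := {K : Box (Fin d) // K ∈ G.cells}

/-- The face of the cell `K` on side `(i, s)`. The set `E(K)` of faces of `K` is indexed by the
pairs `(i, s)`. -/
def face (K : G.Cell) (i : Fin d) (s : Bool) : Face d := boxFace K.1 i s

/-- The volume `|K|` of a cell. -/
def vol (K : G.Cell) : ℝ := ∏ j, (K.1.upper j - K.1.lower j)

/-- `σ = K|L` is an internal face orthogonal to `e^(i)`, and `L` lies above `K` in that
direction. -/
def IsInterface (i : Fin d) (K L : G.Cell) : Prop := G.face K i true = G.face L i false

/-- The internal faces. -/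
def intFaces : Set (Face d) := {σ | ∃ i K L, G.IsInterface i K L ∧ G.face K i true = σ}

/-- `L_M(Ω)`: functions that are constant on each primal cell, given by their cell values. -/
abbrev LM : Type := G.Cell → ℝ

/-- `H_{E,0}(Ω)`: discrete velocities, given by one value `u_σ` (the component `dir σ`) for each
face (equivalently dual cell) of the grid, vanishing on the external faces; a function on all
conceivable faces is understood to vanish also on those that do not belong to the grid. -/
def HE0 : Submodule ℝ (Face d → ℝ) where
  carrier := {u | ∀ σ, σ ∉ G.intFaces → u σ = 0}
  add_mem' := by
    intro a b ha hb σ hσ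
    simp [ha σ hσ, hb σ hσ]
  zero_mem' := by
    intro σ _
    rfl
  smul_mem' := by
    intro c a ha σ hσ
    simp [ha σ hσ]

/-- The face of `K` on side `(i, s)` is internal. -/
def HasNeighbour (K : G.Cell) (i : Fin d) (s : Bool) : Prop :=
  ∃ L : G.Cell, G.face L i (!s) = G.face K i s

open Classical in
/-- The cell `L` with `σ = K|L`, where `σ` is the face of `K` on side `(i, s)`. For an external
face we put `L = K`; external faces do not contribute below. -/
def neighbour (K : G.Cell) (i : Fin d) (s : Bool) : G.Cell :=
  if h : G.HasNeighbour K i s then h.choose else K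

/-- The volume `|D_σ| = |D_{σ,K}| + |D_{σ,L}|` of the dual cell of `σ = K|L`, made of one half of
`K` and one half of `L`. -/
def dualVol (K L : G.Cell) : ℝ := G.vol K / 2 + G.vol L / 2

/-- The dual average `q_{D_σ}`, `σ = K|L`. -/
def dualAvg (q : G.LM) (K L : G.Cell) : ℝ :=
  (G.vol K / 2 * q K + G.vol L / 2 * q L) / G.dualVol K L

/-- The discrete derivative `(∂^(i) q)_σ = |σ| / |D_σ| (q_L - q_K) e^(i) · ν_{σ,K}`, where
`σ = K|L` is the face of `K` on side `(i, s)`; it is zero on external faces. -/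
def grad (q : G.LM) (K : G.Cell) (i : Fin d) (s : Bool) : ℝ :=
  (G.face K i s).area / G.dualVol K (G.neighbour K i s) *
    (q (G.neighbour K i s) - q K) * sideSign s

section Scheme

variable (γ ε η δt : ℝ)

/-- The pressure field `p(ρ)`. -/
def press (ρ : G.LM) : G.LM := fun K => pressure γ (ρ K)

/-- The velocity shift `δu_σ(ρ) = η δt / ε² (∂^(i) p(ρ))_σ`. -/
def velShift (ρ : G.LM) (K : G.Cell) (i : Fin d) (s : Bool) : ℝ :=
  η * δt / ε ^ 2 * G.grad (G.press γ ρ) K i s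

/-- `(v_{σ,K})⁺ = (u_{σ,K})⁺ - (δu_{σ,K}(ρ))⁻`, with `a_{σ,K} = a_σ e^(i) · ν_{σ,K}`. -/
def velPlus (u : G.HE0) (ρ : G.LM) (K : G.Cell) (i : Fin d) (s : Bool) : ℝ :=
  plusPart (u.1 (G.face K i s) * sideSign s) -
    minusPart (G.velShift γ ε η δt ρ K i s * sideSign s)

/-- `(v_{σ,K})⁻ = (u_{σ,K})⁻ - (δu_{σ,K}(ρ))⁺`. -/
def velMinus (u : G.HE0) (ρ : G.LM) (K : G.Cell) (i : Fin d) (s : Bool) : ℝ :=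
  minusPart (u.1 (G.face K i s) * sideSign s) -
    plusPart (G.velShift γ ε η δt ρ K i s * sideSign s)

/-- The upwind mass flux `F_{σ,K}(ρ, v) = |σ| (ρ_K (v_{σ,K})⁺ + ρ_L (v_{σ,K})⁻)` with the
stabilised velocity `v = u - δu(ρ)`, where `σ = K|L` is the face of `K` on side `(i, s)`. It
vanishes on external faces. -/
def massFlux (u : G.HE0) (ρ : G.LM) (K : G.Cell) (i : Fin d) (s : Bool) : ℝ :=
  (G.face K i s).area *
    (ρ K * G.velPlus γ ε η δt u ρ K i s + ρ (G.neighbour K i s) * G.velMinus γ ε η δt u ρ K i s)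

/-- Upwind convection `F u_up` through an edge of a dual cell: `F` is the outgoing flux, `a` the
velocity of the dual cell itself and `b` that of the dual cell on the other side. -/
def upwind (F a b : ℝ) : ℝ := F * (if 0 ≤ F then a else b)

/-- The mass flux out of `D_σ` through its edge orthogonal to `e^(i)` inside the cell `K`, where
`σ` is the face of `K` on side `(i, s)`: with `σ'` the face of `K` opposite to `σ`, it is
`(F_{σ',K} - F_{σ,K}) / 2`. -/
def dualFluxNormal (u : G.HE0) (ρ : G.LM) (K : G.Cell) (i : Fin d) (s : Bool) : ℝ :=
  (G.massFlux γ ε η δt u ρ K i (!s) - G.massFlux γ ε η δt u ρ K i s) / 2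

/-- The mass flux out of `D_σ`, `σ = K|L` orthogonal to `e^(i)`, through its edge on side `(j, t)`,
`j ≠ i`: that edge consists of one half of a face of `K` and one half of a face of `L`, and the
flux is the sum of one half of each of the two primal fluxes. -/
def dualFluxTangent (u : G.HE0) (ρ : G.LM) (K L : G.Cell) (j : Fin d) (t : Bool) : ℝ :=
  (G.massFlux γ ε η δt u ρ K j t + G.massFlux γ ε η δt u ρ L j t) / 2

open Classical in
/-- For `σ = K|L` orthogonal to `e^(i)` with `L` above `K`, the face `σ'` orthogonal to `e^(i)`
whose dual cell lies next to `D_σ` on side `(j, t)`, `j ≠ i`. It is a face of the neighbour of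
`K`, and of the neighbour of `L`, on that side; if only one of them exists it is an external face.
If neither exists, the edge of `D_σ` is external, its flux is zero, and the value is irrelevant. -/
def sideFace (i : Fin d) (K L : G.Cell) (j : Fin d) (t : Bool) : Face d :=
  if G.HasNeighbour K j t then G.face (G.neighbour K j t) i true
  else G.face (G.neighbour L j t) i false

/-- The net upwind momentum convection flux `∑_{ε ∈ E(D_σ)} F_{ε,σ}(ρ, v) u_{ε,up}` for
`σ = K|L` orthogonal to `e^(i)` with `L` above `K`. -/
def momentumFlux (u : G.HE0) (ρ : G.LM) (i : Fin d) (K L : G.Cell) : ℝ :=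
  upwind (G.dualFluxNormal γ ε η δt u ρ K i true)
      (u.1 (G.face K i true)) (u.1 (G.face K i false)) +
    upwind (G.dualFluxNormal γ ε η δt u ρ L i false)
      (u.1 (G.face K i true)) (u.1 (G.face L i true)) +
    ∑ j ∈ Finset.univ.erase i, ∑ t : Bool,
      upwind (G.dualFluxTangent γ ε η δt u ρ K L j t)
        (u.1 (G.face K i true)) (u.1 (G.sideFace i K L j t))

/-- The discrete mass balance on the primal cells, for the data `(ρ, u)` and the unknown `ρ'`. -/
def MassBalance (ρ : G.LM) (u : G.HE0) (ρ' : G.LM) : Prop :=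
  ∀ K : G.Cell,
    1 / δt * (ρ' K - ρ K) +
      1 / G.vol K * ∑ i : Fin d, ∑ s : Bool, G.massFlux γ ε η δt u ρ' K i s = 0

/-- The discrete momentum balance on the dual cells of the internal faces `σ = K|L`. -/
def MomentumBalance (ρ : G.LM) (u : G.HE0) (ρ' : G.LM) (u' : G.HE0) : Prop :=
  ∀ (i : Fin d) (K L : G.Cell), G.IsInterface i K L →
    1 / δt * (G.dualAvg ρ' K L * u'.1 (G.face K i true) -
        G.dualAvg ρ K L * u.1 (G.face K i true)) +
      1 / G.dualVol K L * G.momentumFlux γ ε η δt u ρ' i K L +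
      1 / ε ^ 2 * G.grad (G.press γ ρ') K i true = 0

end Scheme

end MACGrid

end

/-! The momentum convection uses the known velocity, so the scheme decouples: the mass balance
involves only the new density, and the momentum balance is then one scalar linear equation per
internal face, solvable because the dual density is positive. The mass balance is nonlinear, but no
fixed-point theorem is needed. Write it as `T r = ρ`, with `T r` equal to `r` plus the scaled flux
divergence. The fluxes cancel in pairs (`sum_massFlux`), so `T` preserves total mass, and raising
the density of one cell can only increase the flow into the others (`upwindDensity_anti`). On the
compact set of subsolutions `0 ≤ r`, `T r ≤ ρ`, take `r` of maximal mass. If the inequality were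
strict in some cell, its density could be raised slightly: continuity keeps that inequality and
antitonicity keeps the others, contradicting maximality. An empty cell has no outflow, so a solution
has no zeros. -/

open Function in
/-- A continuous map of `ℝ^ι` that preserves a positively weighted sum and is antitone off the
diagonal on the nonnegative orthant attains every positive value at a positive point. -/
theorem exists_pos_eq_of_offDiag_antitone {ι : Type*} [Fintype ι] [DecidableEq ι]
    (T : (ι → ℝ) → ι → ℝ) (hT : Continuous T) (w : ι → ℝ) (hw : ∀ k, 0 < w k)
    (hmass : ∀ r, ∑ k, w k * T r k = ∑ k, w k * r k)
    (hanti : ∀ r, (∀ k, 0 ≤ r k) → ∀ m x, r m ≤ x → ∀ k, k ≠ m → T (update r m x) k ≤ T r k)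
    (hzero : ∀ r, (∀ k, 0 ≤ r k) → ∀ k, r k = 0 → T r k ≤ 0)
    (b : ι → ℝ) (hb : ∀ k, 0 < b k) :
    ∃ r : ι → ℝ, (∀ k, 0 < r k) ∧ ∀ k, T r k = b k := by
  set S : Set (ι → ℝ) := {r | 0 ≤ r ∧ T r ≤ b} with hS
  have hclosed : IsClosed S :=
    (isClosed_le continuous_const continuous_id).inter (isClosed_le hT continuous_const)
  -- Conservation turns the bound on `T r` into a bound on the total mass, hence on each nonnegative
  -- component.
  have hsub : S ⊆ Set.Icc 0 (fun k => (∑ j, w j * b j) / w k) := by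
    rintro r ⟨hr, hrb⟩
    refine ⟨hr, fun k => ?_⟩
    rw [le_div_iff₀ (hw k), mul_comm]
    calc w k * r k ≤ ∑ j, w j * r j :=
          Finset.single_le_sum (f := fun j => w j * r j)
            (fun j _ => mul_nonneg (hw j).le (hr j)) (Finset.mem_univ k)
      _ = ∑ j, w j * T r j := (hmass r).symm
      _ ≤ ∑ j, w j * b j :=
          Finset.sum_le_sum fun j _ => mul_le_mul_of_nonneg_left (hrb j) (hw j).le
  have hcompact : IsCompact S := isCompact_Icc.of_isClosed_subset hclosed hsub
  have hne : S.Nonempty :=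
    ⟨0, le_rfl, fun k => (hzero 0 (fun _ => le_rfl) k rfl).trans (hb k).le⟩
  obtain ⟨r, ⟨hr, hrb⟩, hmax⟩ := hcompact.exists_isMaxOn hne
    (f := fun r => ∑ k, w k * r k) (by fun_prop)
  have heq : ∀ k, T r k = b k := by
    intro k
    by_contra hk
    have hlt : T r k < b k := lt_of_le_of_ne (hrb k) hk
    have hc : Continuous fun x : ℝ => T (update r k x) k :=
      (continuous_apply k).comp (hT.comp (continuous_const.update k continuous_id))
    have hev : ∀ᶠ x in nhdsWithin (r k) (Set.Ioi (r k)), T (update r k x) k < b k :=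
      (hc.continuousAt.eventually_lt_const (by simpa using hlt)).filter_mono nhdsWithin_le_nhds
    obtain ⟨x, hx, hxr⟩ := (hev.and self_mem_nhdsWithin).exists
    have hmem : update r k x ∈ S := by
      refine ⟨fun j => ?_, fun j => ?_⟩
      · rcases eq_or_ne j k with rfl | hj
        · simpa using (hr j).trans hxr.le
        · simpa [hj] using hr j
      · rcases eq_or_ne j k with rfl | hj
        · exact hx.le
        · exact (hanti r hr k x hxr.le j hj).trans (hrb j)
    have hle : ∑ j, w j * update r k x j ≤ ∑ j, w j * r j := hmax hmem
    refine absurd hle (not_le.mpr ?_)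
    refine Finset.sum_lt_sum (fun j _ => ?_) ⟨k, Finset.mem_univ k, ?_⟩
    · rcases eq_or_ne j k with rfl | hj
      · simpa using mul_le_mul_of_nonneg_left hxr.le (hw j).le
      · simp [hj]
    · simpa using mul_lt_mul_of_pos_left hxr (hw k)
  refine ⟨r, fun k => lt_of_le_of_ne (hr k) fun h => ?_, heq⟩
  exact absurd (hzero r hr k h.symm) (by rw [heq k]; exact not_le.mpr (hb k))

/-! ### Two-point upwind fluxes -/

theorem plusPart_nonneg (a : ℝ) : 0 ≤ plusPart a := by
  unfold plusPart; linarith [neg_abs_le a]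

theorem minusPart_nonpos (a : ℝ) : minusPart a ≤ 0 := by
  unfold minusPart; linarith [le_abs_self a]

theorem plusPart_neg (a : ℝ) : plusPart (-a) = -minusPart a := by
  unfold plusPart minusPart; rw [abs_neg]; ring

theorem minusPart_neg (a : ℝ) : minusPart (-a) = -plusPart a := by
  unfold plusPart minusPart; rw [abs_neg]; ring

theorem plusPart_mono : Monotone plusPart := by
  intro a b h
  unfold plusPart
  have := abs_sub_abs_le_abs_sub a b
  rw [abs_of_nonpos (sub_nonpos.mpr h)] at this
  linarith

theorem minusPart_mono : Monotone minusPart := by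
  intro a b h
  have := plusPart_mono (neg_le_neg h)
  rw [plusPart_neg, plusPart_neg] at this
  linarith

@[fun_prop]
theorem continuous_plusPart : Continuous plusPart := by unfold plusPart; fun_prop

@[fun_prop]
theorem continuous_minusPart : Continuous minusPart := by unfold minusPart; fun_prop

theorem sideSign_not (s : Bool) : sideSign (!s) = -sideSign s := by
  cases s <;> simp [sideSign]

theorem sideSign_mul_self (s : Bool) : sideSign s * sideSign s = 1 := by
  cases s <;> simp [sideSign]

theorem continuous_pressure {γ : ℝ} (hγ : 0 ≤ γ) : Continuous (pressure γ) :=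
  continuous_id.rpow_const fun _ => Or.inr hγ

theorem pressure_mono {γ a b : ℝ} (hγ : 0 ≤ γ) (ha : 0 ≤ a) (hab : a ≤ b) :
    pressure γ a ≤ pressure γ b :=
  Real.rpow_le_rpow ha hab hγ

theorem pressure_zero {γ : ℝ} (hγ : γ ≠ 0) : pressure γ 0 = 0 := Real.zero_rpow hγ

/-- The two-point upwind flux density between densities `a` (inside) and `b` (outside), for the
outward velocity `U` and the stabilisation coefficient `c`. -/
noncomputable def upwindDensity (γ U c a b : ℝ) : ℝ :=
  a * (plusPart U - minusPart (c * (pressure γ b - pressure γ a))) +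
    b * (minusPart U - plusPart (c * (pressure γ b - pressure γ a)))

/-- Seen from the other side of a face, velocity and pressure jump change sign, which exchanges the
positive and negative parts. This is local conservation, valid for densities of any sign. -/
theorem upwindDensity_swap (γ U c a b : ℝ) :
    upwindDensity γ (-U) c b a = -upwindDensity γ U c a b := by
  unfold upwindDensity
  have h : c * (pressure γ a - pressure γ b) = -(c * (pressure γ b - pressure γ a)) := by ring
  rw [h, plusPart_neg, minusPart_neg, plusPart_neg, minusPart_neg]
  ring

/-- A larger outside density enlarges the pressure jump, so both stabilising terms push more mass
inwards; the transport term is monotone because its coefficient `minusPart U` is nonpositive. -/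
theorem upwindDensity_anti {γ U c a b b' : ℝ} (hγ : 0 ≤ γ) (hc : 0 ≤ c) (ha : 0 ≤ a)
    (hb : 0 ≤ b) (hbb : b ≤ b') : upwindDensity γ U c a b' ≤ upwindDensity γ U c a b := by
  unfold upwindDensity
  have h : c * (pressure γ b - pressure γ a) ≤ c * (pressure γ b' - pressure γ a) :=
    mul_le_mul_of_nonneg_left (sub_le_sub_right (pressure_mono hγ hb hbb) _) hc
  have h1 := mul_le_mul_of_nonneg_left (minusPart_mono h) ha
  have h2 := mul_le_mul hbb (plusPart_mono h) (plusPart_nonneg _) (hb.trans hbb)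
  have h3 := mul_le_mul_of_nonpos_right hbb (minusPart_nonpos U)
  linarith

theorem upwindDensity_zero_left_nonpos {γ U c b : ℝ} (hb : 0 ≤ b) :
    upwindDensity γ U c 0 b ≤ 0 := by
  unfold upwindDensity
  rw [zero_mul, zero_add]
  exact mul_nonpos_of_nonneg_of_nonpos hb
    (by linarith [minusPart_nonpos U, plusPart_nonneg (c * (pressure γ b - pressure γ 0))])

/-! ### Faces and neighbours -/

/-- Two boxes with disjoint interiors do not share a face on the same side. -/
theorem boxFace_inj_of_not_disjoint {d : ℕ} {K L : Box (Fin d)} {i : Fin d} {s : Bool}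
    (h : boxFace K i s = boxFace L i s) : ¬ Disjoint (Box.Ioo K) (Box.Ioo L) := by
  have hl := congrArg Face.lower h
  have hu := congrArg Face.upper h
  simp only [boxFace] at hl hu
  have hlj : ∀ j, j ≠ i → K.lower j = L.lower j := fun j hj => by
    simpa [hj] using congrFun hl j
  have huj : ∀ j, j ≠ i → K.upper j = L.upper j := fun j hj => by
    simpa [hj] using congrFun hu j
  have hi : (if s then K.upper i else K.lower i) = if s then L.upper i else L.lower i := by
    simpa using congrFun hl i
  -- In direction `i` the two intervals share the endpoint on side `s`; in every other direction
  -- they coincide.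
  have hlt : ∀ j, max (K.lower j) (L.lower j) < min (K.upper j) (L.upper j) := by
    intro j
    have hK := K.lower_lt_upper j
    have hL := L.lower_lt_upper j
    rcases eq_or_ne j i with rfl | hj
    · cases s
      · simp only [Bool.false_eq_true, if_false] at hi
        rw [hi] at hK ⊢
        simp [hK, hL]
      · simp only [if_true] at hi
        rw [hi] at hK ⊢
        simp [hK, hL]
    · rw [hlj j hj, huj j hj]
      simp [hL]
  choose x hx1 hx2 using fun j => exists_between (hlt j)
  refine Set.not_disjoint_iff.mpr ⟨x, ?_, ?_⟩ <;> rw [Box.Ioo] <;> intro j _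
  · exact ⟨(le_max_left _ _).trans_lt (hx1 j), (hx2 j).trans_le (min_le_left _ _)⟩
  · exact ⟨(le_max_right _ _).trans_lt (hx1 j), (hx2 j).trans_le (min_le_right _ _)⟩

theorem boxFace_area_nonneg {d : ℕ} (K : Box (Fin d)) (i : Fin d) (s : Bool) :
    0 ≤ (boxFace K i s).area := by
  refine Finset.prod_nonneg fun j hj => ?_
  have hj : j ≠ i := Finset.ne_of_mem_erase hj
  simpa [boxFace, hj] using K.lower_le_upper j

namespace MACGrid

variable {d : ℕ} {Ω : Set (Fin d → ℝ)} (G : MACGrid d Ω)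

theorem vol_pos (K : G.Cell) : 0 < G.vol K :=
  Finset.prod_pos fun j _ => sub_pos.mpr (K.1.lower_lt_upper j)

theorem dualVol_pos (K L : G.Cell) : 0 < G.dualVol K L :=
  add_pos (half_pos (G.vol_pos K)) (half_pos (G.vol_pos L))

theorem dualVol_comm (K L : G.Cell) : G.dualVol K L = G.dualVol L K := add_comm _ _

theorem dualAvg_pos {q : G.LM} (hq : ∀ K, 0 < q K) (K L : G.Cell) : 0 < G.dualAvg q K L :=
  div_pos (add_pos (mul_pos (half_pos (G.vol_pos K)) (hq K))
    (mul_pos (half_pos (G.vol_pos L)) (hq L))) (G.dualVol_pos K L)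

/-- Makes the chosen neighbour across a face unique, so that taking neighbours is an involution. -/
theorem face_inj {K L : G.Cell} {i : Fin d} {s : Bool} (h : G.face K i s = G.face L i s) :
    K = L := by
  by_contra hne
  exact boxFace_inj_of_not_disjoint h
    (G.disjoint_interior K.1 K.2 L.1 L.2 fun h => hne (Subtype.ext h))

theorem face_neighbour {K : G.Cell} {i : Fin d} {s : Bool} (h : G.HasNeighbour K i s) :
    G.face (G.neighbour K i s) i (!s) = G.face K i s := by
  rw [neighbour, dif_pos h]
  exact h.choose_spec

theorem neighbour_of_not {K : G.Cell} {i : Fin d} {s : Bool} (h : ¬ G.HasNeighbour K i s) :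
    G.neighbour K i s = K := dif_neg h

theorem hasNeighbour_neighbour {K : G.Cell} {i : Fin d} {s : Bool} (h : G.HasNeighbour K i s) :
    G.HasNeighbour (G.neighbour K i s) i (!s) :=
  ⟨K, by rw [G.face_neighbour h, Bool.not_not]⟩

theorem neighbour_neighbour {K : G.Cell} {i : Fin d} {s : Bool} (h : G.HasNeighbour K i s) :
    G.neighbour (G.neighbour K i s) i (!s) = K := by
  have h1 := G.face_neighbour (G.hasNeighbour_neighbour h)
  rw [Bool.not_not, G.face_neighbour h] at h1
  exact G.face_inj h1

theorem hasNeighbour_of_mem_intFaces {K : G.Cell} {i : Fin d} {s : Bool}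
    (h : G.face K i s ∈ G.intFaces) : G.HasNeighbour K i s := by
  obtain ⟨j, A, B, hAB, hA⟩ := h
  obtain rfl : j = i := congrArg Face.dir hA
  cases s
  · exact ⟨A, hA⟩
  · exact ⟨B, by rw [← hA]; exact hAB.symm⟩

/-! ### Mass balance -/

section Scheme

variable (γ ε η δt : ℝ)

/-- The coefficient of the pressure jump in the velocity shift. -/
noncomputable def shiftCoeff (K : G.Cell) (i : Fin d) (s : Bool) : ℝ :=
  η * δt / ε ^ 2 * ((G.face K i s).area / G.dualVol K (G.neighbour K i s))

theorem massFlux_eq (u : G.HE0) (r : G.LM) (K : G.Cell) (i : Fin d) (s : Bool) :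
    G.massFlux γ ε η δt u r K i s = (G.face K i s).area *
      upwindDensity γ (u.1 (G.face K i s) * sideSign s) (G.shiftCoeff ε η δt K i s)
        (r K) (r (G.neighbour K i s)) := by
  have h : G.velShift γ ε η δt r K i s * sideSign s = G.shiftCoeff ε η δt K i s *
      (pressure γ (r (G.neighbour K i s)) - pressure γ (r K)) := by
    simp only [velShift, grad, press, shiftCoeff]
    linear_combination (η * δt / ε ^ 2 * ((G.face K i s).area / G.dualVol K (G.neighbour K i s)) *
      (pressure γ (r (G.neighbour K i s)) - pressure γ (r K))) * sideSign_mul_self s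
  rw [massFlux, velPlus, velMinus, h, upwindDensity]

theorem shiftCoeff_nonneg (hη : 0 ≤ η) (hδt : 0 ≤ δt) (K : G.Cell) (i : Fin d) (s : Bool) :
    0 ≤ G.shiftCoeff ε η δt K i s :=
  mul_nonneg (by positivity) (div_nonneg (boxFace_area_nonneg _ _ _) (G.dualVol_pos _ _).le)

/-- The convention that the neighbour is `K` itself kills the pressure jump, and the velocity
vanishes on external faces. -/
theorem massFlux_of_not_hasNeighbour (u : G.HE0) (r : G.LM) {K : G.Cell} {i : Fin d} {s : Bool}
    (h : ¬ G.HasNeighbour K i s) : G.massFlux γ ε η δt u r K i s = 0 := by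
  have hu : u.1 (G.face K i s) = 0 := u.2 _ fun hm => h (G.hasNeighbour_of_mem_intFaces hm)
  rw [massFlux_eq, G.neighbour_of_not h, hu]
  simp [upwindDensity, plusPart, minusPart]

theorem massFlux_neighbour (u : G.HE0) (r : G.LM) {K : G.Cell} {i : Fin d} {s : Bool}
    (h : G.HasNeighbour K i s) :
    G.massFlux γ ε η δt u r (G.neighbour K i s) i (!s) = -G.massFlux γ ε η δt u r K i s := by
  rw [massFlux_eq, massFlux_eq, shiftCoeff, shiftCoeff, G.neighbour_neighbour h,
    G.face_neighbour h, sideSign_not, mul_neg, upwindDensity_swap, mul_neg,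
    G.dualVol_comm (G.neighbour K i s) K]

theorem sum_massFlux (u : G.HE0) (r : G.LM) :
    ∑ K, ∑ i, ∑ s, G.massFlux γ ε η δt u r K i s = 0 := by
  classical
  have key : ∑ x : G.Cell × Fin d × Bool, G.massFlux γ ε η δt u r x.1 x.2.1 x.2.2 = 0 := by
    -- Pair each side of an internal face with the other; the fixed points are external faces, which
    -- carry no flux.
    refine Finset.sum_involution (fun x _ => if G.HasNeighbour x.1 x.2.1 x.2.2 then
      (G.neighbour x.1 x.2.1 x.2.2, x.2.1, !x.2.2) else x) ?_ ?_ ?_ ?_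
    · rintro ⟨K, i, s⟩ _
      by_cases h : G.HasNeighbour K i s
      · simp [h, G.massFlux_neighbour γ ε η δt u r h]
      · simp [h, G.massFlux_of_not_hasNeighbour γ ε η δt u r h]
    · rintro ⟨K, i, s⟩ _ hne
      by_cases h : G.HasNeighbour K i s
      · simp [h]
      · exact absurd (G.massFlux_of_not_hasNeighbour γ ε η δt u r h) hne
    · intro _ _
      exact Finset.mem_univ _
    · rintro ⟨K, i, s⟩ _
      by_cases h : G.HasNeighbour K i s
      · simp [h, G.hasNeighbour_neighbour h, G.neighbour_neighbour h]
      · simp [h]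
  simpa only [Fintype.sum_prod_type] using key

theorem continuous_massFlux (hγ : 0 ≤ γ) (u : G.HE0) (K : G.Cell) (i : Fin d) (s : Bool) :
    Continuous fun r : G.LM => G.massFlux γ ε η δt u r K i s := by
  have hp := continuous_pressure hγ
  simp only [massFlux_eq, upwindDensity]
  fun_prop

theorem exists_massBalance (hγ : 0 < γ) (hη : 0 ≤ η) (hδt : 0 < δt) (ρ : G.LM) (u : G.HE0)
    (hρ : ∀ K, 0 < ρ K) : ∃ r : G.LM, (∀ K, 0 < r K) ∧ G.MassBalance γ ε η δt ρ u r := by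
  classical
  have hcoef : ∀ K, 0 ≤ δt / G.vol K := fun K => div_nonneg hδt.le (G.vol_pos K).le
  obtain ⟨r, hr, hrT⟩ := exists_pos_eq_of_offDiag_antitone
    (fun (r : G.LM) K => r K + δt / G.vol K * ∑ i, ∑ s, G.massFlux γ ε η δt u r K i s)
    (by
      have := fun K i s => G.continuous_massFlux γ ε η δt hγ.le u K i s
      fun_prop)
    G.vol G.vol_pos
    (by
      intro r
      have h : ∀ K, G.vol K * (r K + δt / G.vol K * ∑ i, ∑ s, G.massFlux γ ε η δt u r K i s) =
          G.vol K * r K + δt * ∑ i, ∑ s, G.massFlux γ ε η δt u r K i s := by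
        intro K
        have := (G.vol_pos K).ne'
        field_simp
      simp only [h]
      rw [Finset.sum_add_distrib, ← Finset.mul_sum, sum_massFlux, mul_zero, add_zero])
    (by
      intro r hr m x hx K hK
      refine add_le_add (by simp [hK]) (mul_le_mul_of_nonneg_left
        (Finset.sum_le_sum fun i _ => Finset.sum_le_sum fun s _ => ?_) (hcoef K))
      rw [massFlux_eq, massFlux_eq, Function.update_of_ne hK]
      refine mul_le_mul_of_nonneg_left (upwindDensity_anti hγ.le
        (G.shiftCoeff_nonneg ε η δt hη hδt.le K i s) (hr K) (hr _) ?_) (boxFace_area_nonneg _ _ _)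
      -- Since `K ≠ m`, the flux changes only through the outside density, and only if the neighbour
      -- is `m`.
      rcases eq_or_ne (G.neighbour K i s) m with h | h
      · rw [h, Function.update_self]
        exact hx
      · rw [Function.update_of_ne h])
    (by
      intro r hr K hK
      simp only [hK, zero_add]
      refine mul_nonpos_of_nonneg_of_nonpos (hcoef K)
        (Finset.sum_nonpos fun i _ => Finset.sum_nonpos fun s _ => ?_)
      rw [massFlux_eq, hK]
      exact mul_nonpos_of_nonneg_of_nonpos (boxFace_area_nonneg _ _ _)
        (upwindDensity_zero_left_nonpos (hr _)))
    ρ hρ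
  refine ⟨r, hr, fun K => ?_⟩
  have hV := (G.vol_pos K).ne'
  have hd := hδt.ne'
  rw [← hrT K]
  field_simp
  ring

/-! ### Momentum balance -/

theorem IsInterface.unique {i j : Fin d} {K L A B : G.Cell} (h : G.IsInterface i K L)
    (h' : G.IsInterface j A B) (hf : G.face A j true = G.face K i true) :
    j = i ∧ A = K ∧ B = L := by
  obtain rfl : j = i := congrArg Face.dir hf
  exact ⟨rfl, G.face_inj hf, G.face_inj (h'.symm.trans (hf.trans h))⟩

/-- A velocity in `H_{E,0}` may be prescribed on the internal faces. -/
theorem exists_velocity (f : Fin d → G.Cell → G.Cell → ℝ) :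
    ∃ u : G.HE0, ∀ i K L, G.IsInterface i K L → u.1 (G.face K i true) = f i K L := by
  classical
  -- The cells are recovered from the face by choice; `IsInterface.unique` shows that the choice is
  -- forced.
  refine ⟨⟨fun σ => if h : σ ∈ G.intFaces then
    f h.choose h.choose_spec.choose h.choose_spec.choose_spec.choose else 0,
    fun σ hσ => dif_neg hσ⟩, fun i K L h => ?_⟩
  have hm : G.face K i true ∈ G.intFaces := ⟨i, K, L, h, rfl⟩
  obtain ⟨h1, h2⟩ := hm.choose_spec.choose_spec.choose_spec
  obtain ⟨hi, hK, hL⟩ := IsInterface.unique G h h1 h2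
  simp only [dif_pos hm]
  rw [hL, hK, hi]

theorem exists_momentumBalance (hδt : δt ≠ 0) (ρ : G.LM) (u : G.HE0) (r : G.LM)
    (hr : ∀ K, 0 < r K) : ∃ u' : G.HE0, G.MomentumBalance γ ε η δt ρ u r u' := by
  obtain ⟨u', hu'⟩ := G.exists_velocity fun i K L =>
    (G.dualAvg ρ K L * u.1 (G.face K i true) -
      δt * (1 / G.dualVol K L * G.momentumFlux γ ε η δt u r i K L +
        1 / ε ^ 2 * G.grad (G.press γ r) K i true)) / G.dualAvg r K L
  refine ⟨u', fun i K L h => ?_⟩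
  rw [hu' i K L h, mul_div_cancel₀ _ (G.dualAvg_pos hr K L).ne', sub_sub_cancel_left, mul_neg,
    ← mul_assoc, one_div_mul_cancel hδt]
  ring

end Scheme

end MACGrid

theorem mainTheorem1 {d : ℕ} {Ω : Set (Fin d → ℝ)} (G : MACGrid d Ω)
    (γ ε η δt : ℝ) (hγ : 1 ≤ γ) (hε : 0 < ε) (hε1 : ε ≤ 1) (hη : 0 < η) (hδt : 0 < δt)
    (ρ : G.LM) (u : G.HE0) (hρ : ∀ K, 0 < ρ K) :
    ∃ (ρ' : G.LM) (u' : G.HE0), (∀ K, 0 < ρ' K) ∧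
      G.MassBalance γ ε η δt ρ u ρ' ∧ G.MomentumBalance γ ε η δt ρ u ρ' u' := by
  obtain ⟨ρ', hpos, hmass⟩ :=
    G.exists_massBalance γ ε η δt (zero_lt_one.trans_le hγ) hη.le hδt ρ u hρ
  obtain ⟨u', hmom⟩ := G.exists_momentumBalance γ ε η δt hδt.ne' ρ u ρ' hpos
  exact ⟨ρ', u', hpos, hmass, hmom⟩
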